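/- Let $N\ge 2$, let $J_1,\dots,J_{N-1}>0$ and $b\in\mathbb{R}$, and consider the one-dimensional Heisenberg Hamiltonian on $N$ qubits with no ($b=0$) or uniform magnetic field, $$H=\sum_{n=1}^{N-1}J_n\,(X_nX_{n+1}+Y_nY_{n+1}+Z_nZ_{n+1})+b\sum_{n=1}^{N}Z_n,$$ where $X_n,Y_n,Z_n$ are the Pauli matrices acting on qubit $n$. The chain is said to exhibit end-to-end perfect state transfer if there are a time $t_0>0$ and a phase $\phi\in\mathbb{R}$ such that $$e^{-iHt_0}\,|100\cdots0\rangle=e^{i\phi}\,|00\cdots01\rangle .$$ Then the chain exhibits end-to-end perfect state transfer if and only if $N=2$. In other words, for $N=2$ perfect transfer occurs for every choice of $J_1>0$ and $b$, while for $N\ge 3$ it occurs for no choice of positive couplings and uniform field. -/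

import Mathlib

noncomputable section

namespace SpinChain

/-- Computational basis labels of `N` qubits: each site is in state `0` or `1`. -/
abbrev Config (N : ℕ) := Fin N → Fin 2

/-- Operators on the `2 ^ N`-dimensional Hilbert space `(ℂ²)^{⊗N}`,
written in the computational basis. -/
abbrev Op (N : ℕ) := Matrix (Config N) (Config N) ℂ

/-- The Pauli matrix `X`. -/
def pauliX : Matrix (Fin 2) (Fin 2) ℂ := !![0, 1; 1, 0]

/-- The Pauli matrix `Y`. -/
def pauliY : Matrix (Fin 2) (Fin 2) ℂ := !![0, -Complex.I; Complex.I, 0]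

/-- The Pauli matrix `Z`. -/
def pauliZ : Matrix (Fin 2) (Fin 2) ℂ := !![1, 0; 0, -1]

/-- `I ⊗ ⋯ ⊗ A ⊗ ⋯ ⊗ I`: the single-qubit operator `A` acting on site `n`. -/
def onSite {N : ℕ} (A : Matrix (Fin 2) (Fin 2) ℂ) (n : Fin N) : Op N :=
  Matrix.of fun s s' => if ∀ m, m ≠ n → s m = s' m then A (s n) (s' n) else 0

/-- The left end of the `n`-th link, i.e. site `n` of the chain. -/
def leftSite {N : ℕ} (n : Fin (N - 1)) : Fin N := ⟨n, by omega⟩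

/-- The right end of the `n`-th link, i.e. site `n + 1` of the chain. -/
def rightSite {N : ℕ} (n : Fin (N - 1)) : Fin N := ⟨n + 1, by omega⟩

/-- The exchange Hamiltonian
`∑ Jₙ (Xₙ Xₙ₊₁ + Yₙ Yₙ₊₁) + ∑ Bₙ Zₙ` of a chain of `N` qubits. -/
def exchangeHamiltonian (N : ℕ) (J : Fin (N - 1) → ℝ) (B : Fin N → ℝ) : Op N :=
  ∑ n : Fin (N - 1), (J n : ℂ) •
      (onSite pauliX (leftSite n) * onSite pauliX (rightSite n)
        + onSite pauliY (leftSite n) * onSite pauliY (rightSite n))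
    + ∑ n : Fin N, (B n : ℂ) • onSite pauliZ n

/-- The Heisenberg Hamiltonian
`∑ Jₙ (Xₙ Xₙ₊₁ + Yₙ Yₙ₊₁ + Zₙ Zₙ₊₁) + ∑ Bₙ Zₙ` of a chain of `N` qubits. -/
def heisenbergHamiltonian (N : ℕ) (J : Fin (N - 1) → ℝ) (B : Fin N → ℝ) : Op N :=
  exchangeHamiltonian N J B
    + ∑ n : Fin (N - 1), (J n : ℂ) •
        (onSite pauliZ (leftSite n) * onSite pauliZ (rightSite n))

/-- The basis state with site `n` in state `1` and all other sites in state `0`. -/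
def excitation {N : ℕ} (n : Fin N) : Config N → ℂ :=
  Pi.single (fun m => if m = n then 1 else 0) 1

/-- The time evolution operator `e^{-iHt}`. -/
def evolution {N : ℕ} (H : Op N) (t : ℝ) : Op N :=
  NormedSpace.exp ((-(Complex.I * (t : ℂ))) • H)

/-- End-to-end perfect state transfer: for some transfer time `t₀ > 0` and some phase `φ`,
`e^{-iHt₀} |10…0⟩ = e^{iφ} |0…01⟩`. -/
def HasEndToEndPST {N : ℕ} (hN : 0 < N) (H : Op N) : Prop :=
  ∃ t₀ : ℝ, 0 < t₀ ∧ ∃ φ : ℝ,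
    Matrix.mulVec (evolution H t₀) (excitation ⟨0, hN⟩)
      = Complex.exp (Complex.I * (φ : ℂ)) • excitation ⟨N - 1, Nat.sub_lt hN Nat.one_pos⟩

end SpinChain

end

/-! On a link, `XX + YY + ZZ` is twice the swap minus the identity. On states with one excitation,
`H` is therefore a scalar plus twice the weighted path Laplacian with the couplings as weights; the
uniform field only shifts the scalar.

Suppose the evolution `U` transfers the end excitation with phase `q`. Since `U` commutes with `H`
and is unitary, moving inwards from the end shows that `U` is `q` times the mirror reflection and
that the couplings are symmetric (`mirror_of_transfer`). The constant vector has Laplacian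
eigenvalue `0` and phase `q`, so relative to it symmetric eigenvectors have phase `1` and
antisymmetric ones phase `-1`. In units of `π / (2 t)` their eigenvalues are even and odd integers
respectively (`exp_eq_of_half_root`).

Both families are root sets of explicit half-chain polynomials. Vieta's formulas relate the product
of the odd eigenvalues to that of the nonzero even ones, and the powers of two disagree once `N ≥ 3`
(`false_of_roots_odd_length`, `false_of_roots_even_length`). For `N = 2` a single phase difference
has to equal `π` (`transfer_of_length_two`). -/

noncomputable section

namespace SpinChain

open Polynomial

/-! ### Half-chain polynomials. -/

/-- For couplings `j`, the monic multiples of the amplitude at site `k` and of the sum of the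
amplitudes at sites `0, …, k` of the solution of the recurrence
`j k * (u (k + 1) - u k) = j (k - 1) * (u k - u (k - 1)) + X * u k` with `u 0 = 1`. -/
def amplitudePair (j : ℕ → ℂ) : ℕ → ℂ[X] × ℂ[X]
  | 0 => (1, 1)
  | k + 1 =>
    (C (j k) * (amplitudePair j k).1 + X * (amplitudePair j k).2,
      C (j k) * (amplitudePair j k).2 +
        (C (j k) * (amplitudePair j k).1 + X * (amplitudePair j k).2))

/-- The monic multiple of the amplitude at site `k`. -/
def amplitude (j : ℕ → ℂ) (k : ℕ) : ℂ[X] := (amplitudePair j k).1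

/-- The monic multiple of the sum of the amplitudes at sites `0, …, k`. -/
def amplitudeSum (j : ℕ → ℂ) (k : ℕ) : ℂ[X] := (amplitudePair j k).2

lemma amplitude_zero (j : ℕ → ℂ) : amplitude j 0 = 1 := rfl

lemma amplitudeSum_zero (j : ℕ → ℂ) : amplitudeSum j 0 = 1 := rfl

lemma amplitude_succ (j : ℕ → ℂ) (k : ℕ) :
    amplitude j (k + 1) = C (j k) * amplitude j k + X * amplitudeSum j k := rfl

lemma amplitudeSum_succ (j : ℕ → ℂ) (k : ℕ) :
    amplitudeSum j (k + 1) = C (j k) * amplitudeSum j k + amplitude j (k + 1) := rfl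

/-- Adding a polynomial of smaller degree preserves being monic of degree `d + 1`. -/
lemma monic_natDegree_C_mul_add {p q : ℂ[X]} {d : ℕ} (c : ℂ) (hp : p.natDegree ≤ d)
    (hq : q.Monic ∧ q.natDegree = d + 1) :
    (C c * p + q).Monic ∧ (C c * p + q).natDegree = d + 1 := by
  have h : (C c * p).natDegree < q.natDegree := by
    have := natDegree_C_mul_le c p
    omega
  refine ⟨hq.1.add_of_right (degree_lt_degree h), ?_⟩
  rw [natDegree_add_eq_right_of_natDegree_lt h, hq.2]

lemma monic_natDegree_X_mul {p : ℂ[X]} {d : ℕ} (hp : p.Monic ∧ p.natDegree = d) :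
    (X * p).Monic ∧ (X * p).natDegree = d + 1 :=
  ⟨monic_X.mul hp.1, by rw [natDegree_X_mul hp.1.ne_zero, hp.2]⟩

lemma monic_natDegree_amplitude (j : ℕ → ℂ) (k : ℕ) :
    ((amplitude j k).Monic ∧ (amplitude j k).natDegree = k) ∧
      ((amplitudeSum j k).Monic ∧ (amplitudeSum j k).natDegree = k) := by
  induction k with
  | zero => simp [amplitude_zero, amplitudeSum_zero]
  | succ k ih =>
    have h : (amplitude j (k + 1)).Monic ∧ (amplitude j (k + 1)).natDegree = k + 1 := by
      rw [amplitude_succ]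
      exact monic_natDegree_C_mul_add _ ih.1.2.le (monic_natDegree_X_mul ih.2)
    refine ⟨h, ?_⟩
    rw [amplitudeSum_succ]
    exact monic_natDegree_C_mul_add _ ih.2.2.le h

/-- At eigenvalue `0` the solution is constantly `1`, so only the normalising product survives; in
the next lemma the sum counts the `k + 1` sites. -/
lemma amplitude_coeff_zero (j : ℕ → ℂ) (k : ℕ) :
    (amplitude j k).coeff 0 = ∏ i ∈ Finset.range k, j i := by
  induction k with
  | zero => simp [amplitude_zero]
  | succ k ih => simp [amplitude_succ, ih, Finset.prod_range_succ, mul_comm]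

lemma amplitudeSum_coeff_zero (j : ℕ → ℂ) (k : ℕ) :
    (amplitudeSum j k).coeff 0 = (k + 1) * ∏ i ∈ Finset.range k, j i := by
  induction k with
  | zero => simp [amplitudeSum_zero]
  | succ k ih =>
    simp only [amplitudeSum_succ, coeff_add, coeff_C_mul, ih, amplitude_coeff_zero,
      Finset.prod_range_succ]
    push_cast
    ring

/-! ### The parity obstruction. -/

/-- A monic complex polynomial all of whose roots are integers with property `P` has as many
of them as its degree says, and they give its coefficients by Vieta's formulas. -/
lemma exists_multiset_int_roots {P : ℤ → Prop} {p : ℂ[X]} {d : ℕ}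
    (hp : p.Monic ∧ p.natDegree = d) (h : ∀ x, p.eval x = 0 → ∃ k : ℤ, P k ∧ x = k) :
    ∃ s : Multiset ℤ, (∀ k ∈ s, P k) ∧ s.card = d ∧
      p.coeff 0 = (-1) ^ d * (s.prod : ℤ) ∧ p.nextCoeff = -(s.sum : ℤ) := by
  have hs : p.Splits := IsAlgClosed.splits p
  have hr : ∀ x ∈ p.roots, ∃ k : ℤ, P k ∧ x = k := fun x hx => h x (mem_roots'.1 hx).2
  have key : ∀ t : Multiset ℂ, (∀ x ∈ t, ∃ k : ℤ, P k ∧ x = k) →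
      ∃ s : Multiset ℤ, (∀ k ∈ s, P k) ∧ s.map (fun k : ℤ => (k : ℂ)) = t := by
    intro t
    induction t using Multiset.induction with
    | empty => exact fun _ => ⟨0, by simp⟩
    | cons a t ih =>
      intro ht
      obtain ⟨s, hs, rfl⟩ := ih fun x hx => ht x (Multiset.mem_cons_of_mem hx)
      obtain ⟨k, hk, rfl⟩ := ht a (Multiset.mem_cons_self _ _)
      refine ⟨k ::ₘ s, ?_, by simp⟩
      simpa [hk] using hs
  obtain ⟨s, hsP, hsr⟩ := key p.roots hr
  have hcard : s.card = d := by
    rw [← hp.2, hs.natDegree_eq_card_roots, ← hsr, Multiset.card_map]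
  refine ⟨s, hsP, hcard, ?_, ?_⟩
  · rw [hs.coeff_zero_eq_prod_roots_of_monic hp.1, ← hsr, hp.2]
    congr 1
    exact (map_multiset_prod (Int.castRingHom ℂ) s).symm
  · rw [hs.nextCoeff_eq_neg_sum_roots_of_monic hp.1, ← hsr]
    congr 1
    exact (map_multiset_sum (Int.castRingHom ℂ) s).symm

lemma odd_multiset_prod {s : Multiset ℤ} (h : ∀ k ∈ s, Odd k) : Odd s.prod := by
  induction s using Multiset.induction with
  | empty => simp
  | cons a s ih =>
    rw [Multiset.prod_cons]
    exact (h a (Multiset.mem_cons_self _ _)).mul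
      (ih fun k hk => h k (Multiset.mem_cons_of_mem hk))

lemma two_pow_card_dvd_multiset_prod {s : Multiset ℤ} (h : ∀ k ∈ s, Even k) :
    2 ^ s.card ∣ s.prod := by
  induction s using Multiset.induction with
  | empty => simp
  | cons a s ih =>
    rw [Multiset.prod_cons, Multiset.card_cons, pow_succ, mul_comm]
    exact mul_dvd_mul (h a (Multiset.mem_cons_self _ _)).two_dvd
      (ih fun k hk => h k (Multiset.mem_cons_of_mem hk))

lemma even_multiset_sum {s : Multiset ℤ} (h : ∀ k ∈ s, Even k) : Even s.sum := by
  induction s using Multiset.induction with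
  | empty => simp
  | cons a s ih =>
    rw [Multiset.sum_cons]
    exact (h a (Multiset.mem_cons_self _ _)).add
      (ih fun k hk => h k (Multiset.mem_cons_of_mem hk))

lemma even_multiset_sum_sub_card {s : Multiset ℤ} (h : ∀ k ∈ s, Odd k) :
    Even (s.sum - s.card) := by
  induction s using Multiset.induction with
  | empty => simp
  | cons a s ih =>
    have h1 := (h a (Multiset.mem_cons_self _ _)).sub_odd odd_one
    have h2 := ih fun k hk => h k (Multiset.mem_cons_of_mem hk)
    have e : (a ::ₘ s).sum - (a ::ₘ s).card = a - 1 + (s.sum - s.card) := by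
      rw [Multiset.sum_cons, Multiset.card_cons]
      push_cast
      ring
    exact e ▸ h1.add h2

/-- In a mirror-symmetric chain of odd length, the antisymmetric eigenvalues cannot all be odd
integers while the nonzero symmetric ones are all even integers. -/
lemma false_of_roots_odd_length (j : ℕ → ℂ) (m : ℕ)
    (ho : ∀ x : ℂ, (amplitude j (m + 1)).eval x = 0 → ∃ k : ℤ, Odd k ∧ x = k)
    (he : ∀ x : ℂ, (C (2 * j m) * amplitudeSum j m + amplitude j (m + 1)).eval x = 0 →
      ∃ k : ℤ, Even k ∧ x = k) : False := by
  have hV := (monic_natDegree_amplitude j (m + 1)).1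
  have hE := monic_natDegree_C_mul_add (2 * j m) (monic_natDegree_amplitude j m).2.2.le hV
  obtain ⟨s, hs, hsc, hs0, -⟩ := exists_multiset_int_roots hV ho
  obtain ⟨r, hr, hrc, hr0, -⟩ := exists_multiset_int_roots hE he
  -- The ratio of the constant terms is the chain length `2 * m + 3`, an odd number.
  have hrel : (C (2 * j m) * amplitudeSum j m + amplitude j (m + 1)).coeff 0
      = (2 * m + 3) * (amplitude j (m + 1)).coeff 0 := by
    simp only [coeff_add, coeff_C_mul, amplitudeSum_coeff_zero, amplitude_coeff_zero,
      Finset.prod_range_succ]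
    ring
  -- Both degrees are `m + 1`, so the signs in Vieta's formulas cancel.
  rw [hr0, hs0, mul_left_comm] at hrel
  have hrel' : r.prod = (2 * m + 3) * s.prod := by
    exact_mod_cast mul_left_cancel₀ (pow_ne_zero _ (by norm_num)) hrel
  have h1 : Odd r.prod := by
    rw [hrel']
    exact Odd.mul ⟨m + 1, by ring⟩ (odd_multiset_prod hs)
  have h2 := two_pow_card_dvd_multiset_prod hr
  rw [hrc, pow_succ] at h2
  exact (Int.not_even_iff_odd.2 h1) (even_iff_two_dvd.2 ((dvd_mul_left _ _).trans h2))

/-- In a mirror-symmetric chain of even length at least four, the antisymmetric eigenvalues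
cannot all be odd integers while the nonzero symmetric ones are all even integers. -/
lemma false_of_roots_even_length (j : ℕ → ℂ) (m : ℕ)
    (ho : ∀ x : ℂ, (C (2 * j (m + 1)) * amplitude j (m + 1) + X * amplitudeSum j (m + 1)).eval x = 0 →
      ∃ k : ℤ, Odd k ∧ x = k)
    (he : ∀ x : ℂ, (amplitudeSum j (m + 1)).eval x = 0 → ∃ k : ℤ, Even k ∧ x = k) : False := by
  have hV := (monic_natDegree_amplitude j (m + 1)).1
  have hS := (monic_natDegree_amplitude j (m + 1)).2
  have hA := monic_natDegree_C_mul_add (2 * j (m + 1)) hV.2.le (monic_natDegree_X_mul hS)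
  obtain ⟨s, hs, hsc, hs0, hs1⟩ := exists_multiset_int_roots hA ho
  obtain ⟨r, hr, hrc, hr0, hr1⟩ := exists_multiset_int_roots hS he
  -- Comparing the second-highest coefficients expresses the middle coupling through the two
  -- eigenvalue sums.
  have hnext : 2 * j (m + 1) = ((r.sum - s.sum : ℤ) : ℂ) := by
    have h1 : (C (2 * j (m + 1)) * amplitude j (m + 1) + X * amplitudeSum j (m + 1)).nextCoeff
        = 2 * j (m + 1) + (amplitudeSum j (m + 1)).nextCoeff := by
      rw [nextCoeff_of_natDegree_pos (by omega), nextCoeff_of_natDegree_pos (by omega), hA.2, hS.2]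
      simp only [Nat.add_sub_cancel, coeff_add, coeff_C_mul, coeff_X_mul]
      have : (amplitude j (m + 1)).coeff (m + 1) = 1 := by
        simpa [Monic, leadingCoeff, hV.2] using hV.1
      rw [this, mul_one]
    rw [hs1, hr1] at h1
    rw [Int.cast_sub]
    linear_combination -h1
  -- Cross-multiplying the constant terms eliminates the product of the outer couplings.
  have hrel : (m + 2) * (C (2 * j (m + 1)) * amplitude j (m + 1)
      + X * amplitudeSum j (m + 1)).coeff 0
      = 2 * j (m + 1) * (amplitudeSum j (m + 1)).coeff 0 := by
    simp only [coeff_add, amplitudeSum_coeff_zero, amplitude_coeff_zero, mul_coeff_zero,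
      coeff_X_zero, coeff_C_zero]
    push_cast
    ring
  rw [hs0, hr0, hnext, pow_succ] at hrel
  have hrel' : (m + 2) * s.prod = (s.sum - r.sum) * r.prod := by
    have h0 : ((-1 : ℂ)) ^ (m + 1) ≠ 0 := pow_ne_zero _ (by norm_num)
    have : ((m : ℂ) + 2) * (s.prod : ℤ) = ((s.sum - r.sum : ℤ) : ℂ) * (r.prod : ℤ) := by
      apply mul_left_cancel₀ h0
      rw [Int.cast_sub] at hrel ⊢
      linear_combination -hrel
    exact_mod_cast this
  have hodd := odd_multiset_prod hs
  -- There are `m + 2` odd eigenvalues, and the others are even.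
  have hsum : Even (s.sum - r.sum - (m + 2)) := by
    have := (even_multiset_sum_sub_card hs).sub (even_multiset_sum hr)
    rw [hsc] at this
    have e : s.sum - r.sum - (m + 2) = s.sum - ((m + 1 + 1 : ℕ) : ℤ) - r.sum := by
      push_cast
      ring
    exact e ▸ this
  have hr2 := two_pow_card_dvd_multiset_prod hr
  rw [hrc] at hr2
  -- If `m + 2` is even, the sum factor supplies one more `2`, so `2 ^ (m + 2)` would divide `m +
  -- 2`. If it is odd, the left side of `hrel'` is odd while `r.prod` is even, as `r` has `m + 1 ≥
  -- 1` elements.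
  rcases Int.even_or_odd (m + 2 : ℤ) with hm | hm
  · have h2 : (2 : ℤ) ^ (m + 2) ∣ (m + 2) * s.prod := by
      rw [hrel', pow_succ, mul_comm]
      refine mul_dvd_mul (even_iff_two_dvd.1 ?_) hr2
      simpa using hsum.add hm
    have hcop : IsCoprime ((2 : ℤ) ^ (m + 2)) s.prod :=
      (Int.isCoprime_iff_gcd_eq_one.2 (by
        have := Int.isCoprime_iff_gcd_eq_one.1 (Int.isCoprime_two_left.2 hodd)
        exact this)).pow_left
    have h3 := Int.le_of_dvd (by positivity) (hcop.dvd_of_dvd_mul_right h2)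
    have h4 : ((m + 2 : ℕ) : ℤ) < (2 ^ (m + 2) : ℕ) := by exact_mod_cast Nat.lt_two_pow_self
    push_cast at h4
    omega
  · have h1 : Odd ((s.sum - r.sum) * r.prod) := hrel' ▸ hm.mul hodd
    rw [pow_succ] at hr2
    exact (Int.not_even_iff_odd.2 (Int.odd_mul.1 h1).2)
      (even_iff_two_dvd.2 ((dvd_mul_left _ _).trans hr2))

/-! ### Matrix exponentials and one-site operators. -/

/-- The exponential of a matrix acts on an eigenvector by the exponential of the eigenvalue. -/
lemma exp_mulVec_of_mulVec_eq_smul {ι : Type*} [Fintype ι] [DecidableEq ι] {A : Matrix ι ι ℂ}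
    {v : ι → ℂ} {a : ℂ} (h : A.mulVec v = a • v) :
    (NormedSpace.exp A).mulVec v = Complex.exp a • v := by
  let _ : NormedRing (Matrix ι ι ℂ) := Matrix.linftyOpNormedRing
  let _ : NormedAlgebra ℂ (Matrix ι ι ℂ) := Matrix.linftyOpNormedAlgebra
  have hpow : ∀ n : ℕ, (A ^ n).mulVec v = a ^ n • v := by
    intro n
    induction n with
    | zero => simp
    | succ n ih =>
      rw [pow_succ, ← Matrix.mulVec_mulVec, h, Matrix.mulVec_smul, ih, smul_smul, pow_succ,
        mul_comm]
  have h1 := (NormedSpace.exp_series_hasSum_exp' (𝕂 := ℂ) A).map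
    ({ toFun := fun M : Matrix ι ι ℂ => M.mulVec v
       map_zero' := Matrix.zero_mulVec v
       map_add' := fun M N => Matrix.add_mulVec M N v } : Matrix ι ι ℂ →+ (ι → ℂ))
    (by change Continuous fun M : Matrix ι ι ℂ => M.mulVec v; fun_prop)
  have h2 := (NormedSpace.exp_series_hasSum_exp' (𝕂 := ℂ) a).smul_const v
  rw [Complex.exp_eq_exp_ℂ]
  refine h1.unique ?_
  convert h2 using 1
  funext n
  simp [Matrix.smul_mulVec, hpow, smul_smul]

open Matrix

variable {N : ℕ}

lemma onSite_mulVec (A : Matrix (Fin 2) (Fin 2) ℂ) (n : Fin N) (v : Config N → ℂ)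
    (s : Config N) :
    (onSite A n *ᵥ v) s = ∑ a, A (s n) a * v (Function.update s n a) := by
  symm
  refine Finset.sum_of_injOn (fun a => Function.update s n a)
    (fun a _ b _ h => Function.update_injective s n h) (fun a _ => Finset.mem_coe.2
      (Finset.mem_univ _)) ?_ ?_
  · intro s' _ hs'
    have : ¬ ∀ m, m ≠ n → s m = s' m := by
      intro h
      refine hs' ⟨s' n, Finset.mem_coe.2 (Finset.mem_univ _), ?_⟩
      funext m
      by_cases hm : m = n
      · subst hm; simp
      · simp [hm, h m hm]
    simp [onSite, this]
  · intro a _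
    have : ∀ m, m ≠ n → s m = Function.update s n a m := fun m hm => by simp [hm]
    simp only [onSite, of_apply]
    rw [if_pos this, Function.update_self]

lemma conjTranspose_onSite (A : Matrix (Fin 2) (Fin 2) ℂ) (n : Fin N) :
    (onSite A n)ᴴ = onSite Aᴴ n := by
  ext s s'
  simp only [onSite, conjTranspose_apply, of_apply]
  by_cases h : ∀ m, m ≠ n → s m = s' m
  · rw [if_pos h, if_pos fun m hm => (h m hm).symm]
  · rw [if_neg h, if_neg fun h' => h fun m hm => (h' m hm).symm, star_zero]

lemma onSite_commute (A B : Matrix (Fin 2) (Fin 2) ℂ) {l r : Fin N} (h : l ≠ r) :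
    onSite A l * onSite B r = onSite B r * onSite A l := by
  refine ext_of_mulVec_single fun s => ?_
  generalize (Pi.single s 1 : Config N → ℂ) = v
  funext s
  simp only [← mulVec_mulVec, onSite_mulVec, Finset.mul_sum]
  rw [Finset.sum_comm]
  refine Finset.sum_congr rfl fun b _ => Finset.sum_congr rfl fun a _ => ?_
  rw [Function.update_of_ne h, Function.update_of_ne h.symm, Function.update_comm h]
  ring

lemma isHermitian_onSite {A : Matrix (Fin 2) (Fin 2) ℂ} (hA : A.IsHermitian) (n : Fin N) :
    (onSite A n).IsHermitian := by
  rw [IsHermitian, conjTranspose_onSite, hA.eq]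

lemma isHermitian_onSite_mul_onSite {A : Matrix (Fin 2) (Fin 2) ℂ} (hA : A.IsHermitian)
    {l r : Fin N} (h : l ≠ r) : (onSite A l * onSite A r).IsHermitian := by
  rw [IsHermitian, conjTranspose_mul, isHermitian_onSite hA, isHermitian_onSite hA,
    onSite_commute _ _ h]

lemma isHermitian_pauliX : pauliX.IsHermitian := by
  ext i j; fin_cases i <;> fin_cases j <;> simp [pauliX]

lemma isHermitian_pauliY : pauliY.IsHermitian := by
  ext i j; fin_cases i <;> fin_cases j <;> simp [pauliY]

lemma isHermitian_pauliZ : pauliZ.IsHermitian := by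
  ext i j; fin_cases i <;> fin_cases j <;> simp [pauliZ]

lemma leftSite_ne_rightSite (n : Fin (N - 1)) : leftSite n ≠ rightSite n := by
  simp [leftSite, rightSite, Fin.ext_iff]

lemma isHermitian_real_smul {A : Op N} (hA : A.IsHermitian) (c : ℝ) :
    ((c : ℂ) • A).IsHermitian := by
  rw [IsHermitian, conjTranspose_smul, hA.eq, Complex.star_def, Complex.conj_ofReal]

lemma isHermitian_finset_sum {ι : Type*} (t : Finset ι) {A : ι → Op N}
    (hA : ∀ i ∈ t, (A i).IsHermitian) : (∑ i ∈ t, A i).IsHermitian := by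
  rw [IsHermitian, conjTranspose_sum]
  exact Finset.sum_congr rfl hA

lemma isHermitian_heisenbergHamiltonian (J : Fin (N - 1) → ℝ) (B : Fin N → ℝ) :
    (heisenbergHamiltonian N J B).IsHermitian := by
  refine ((isHermitian_finset_sum _ fun n _ => isHermitian_real_smul ?_ _).add
    (isHermitian_finset_sum _ fun n _ => isHermitian_real_smul ?_ _)).add
    (isHermitian_finset_sum _ fun n _ => isHermitian_real_smul ?_ _)
  · exact (isHermitian_onSite_mul_onSite isHermitian_pauliX (leftSite_ne_rightSite n)).add
      (isHermitian_onSite_mul_onSite isHermitian_pauliY (leftSite_ne_rightSite n))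
  · exact isHermitian_onSite isHermitian_pauliZ n
  · exact isHermitian_onSite_mul_onSite isHermitian_pauliZ (leftSite_ne_rightSite n)

lemma evolution_conjTranspose_mul_self {H : Op N} (hH : H.IsHermitian) (t : ℝ) :
    (evolution H t)ᴴ * evolution H t = 1 := by
  rw [evolution, ← exp_conjTranspose, conjTranspose_smul, hH.eq]
  have : star (-(Complex.I * (t : ℂ))) = Complex.I * t := by simp
  rw [this, ← exp_add_of_commute _ _ ((Commute.refl H).smul_left _ |>.smul_right _), ← add_smul]
  simp [NormedSpace.exp_zero]

lemma evolution_mul_comm (H : Op N) (t : ℝ) : evolution H t * H = H * evolution H t := by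
  let _ : NormedRing (Op N) := Matrix.linftyOpNormedRing
  let _ : NormedAlgebra ℂ (Op N) := Matrix.linftyOpNormedAlgebra
  exact (((Commute.refl H).smul_right (-(Complex.I * (t : ℂ)))).exp_right).eq.symm

/-- This is the identity `XX + YY + ZZ = 2 SWAP - 1`, checked on the four values of the two sites.
-/
lemma pauli_sum_mulVec {l r : Fin N} (h : l ≠ r) (v : Config N → ℂ) (s : Config N) :
    ((onSite pauliX l * onSite pauliX r + onSite pauliY l * onSite pauliY r
      + onSite pauliZ l * onSite pauliZ r) *ᵥ v) s = 2 * v (s ∘ Equiv.swap l r) - v s := by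
  have key : ∀ a b, s l = a → s r = b →
      Function.update (Function.update s l b) r a = s ∘ Equiv.swap l r ∧
      Function.update (Function.update s l a) r b = s := by
    rintro a b rfl rfl
    constructor
    · funext m
      by_cases hr : m = r
      · subst hr; simp
      · by_cases hl : m = l
        · subst hl; simp [hr]
        · simp [hr, hl, Equiv.swap_apply_of_ne_of_ne hl hr]
    · simp
  simp only [add_mulVec, Pi.add_apply, ← mulVec_mulVec, onSite_mulVec, Fin.sum_univ_two,
    Function.update_of_ne h.symm]
  have h2 : ∀ x : Fin 2, x = 0 ∨ x = 1 := by decide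
  rcases h2 (s l) with hl | hl <;> rcases h2 (s r) with hr | hr <;>
    obtain ⟨k1, k2⟩ := key _ _ hl hr <;>
    rw [hl, hr, ← congrArg v k1, ← congrArg v k2]
  all_goals
    generalize v (Function.update (Function.update s l 0) r 0) = x00
    generalize v (Function.update (Function.update s l 0) r 1) = x01
    generalize v (Function.update (Function.update s l 1) r 0) = x10
    generalize v (Function.update (Function.update s l 1) r 1) = x11
    simp [pauliX, pauliY, pauliZ]
    ring_nf
    rw [Complex.I_sq]
    ring

/-! ### The one-excitation sector. -/

/-- The basis configuration with a single excitation at site `k`. -/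
def siteConfig (N k : ℕ) : Config N := fun m => if (m : ℕ) = k then 1 else 0

/-- The basis vector with a single excitation at site `k`. -/
def siteVec (N k : ℕ) : Config N → ℂ := Pi.single (siteConfig N k) 1

lemma excitation_eq_siteVec (n : Fin N) : excitation n = siteVec N n := by
  unfold excitation siteVec siteConfig
  simp only [Fin.ext_iff]

lemma siteConfig_inj {k l : ℕ} (hk : k < N) : siteConfig N k = siteConfig N l ↔ k = l := by
  refine ⟨fun h => ?_, fun h => h ▸ rfl⟩
  by_contra hne
  have := congrFun h ⟨k, hk⟩
  simp [siteConfig, hne] at this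

lemma siteConfig_comp_swap (n : Fin (N - 1)) (k : ℕ) :
    siteConfig N k ∘ Equiv.swap (leftSite n) (rightSite n)
      = siteConfig N (Equiv.swap (n : ℕ) (n + 1) k) := by
  funext m
  simp only [Function.comp, siteConfig, Equiv.swap_apply_def, leftSite, rightSite, Fin.ext_iff]
  split_ifs <;> simp_all

/-- In this form the second term vanishes for every link that does not touch the excitation. -/
lemma link_mulVec_siteVec (n : Fin (N - 1)) (k : ℕ) :
    (onSite pauliX (leftSite n) * onSite pauliX (rightSite n)
      + onSite pauliY (leftSite n) * onSite pauliY (rightSite n)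
      + onSite pauliZ (leftSite n) * onSite pauliZ (rightSite n)) *ᵥ siteVec N k
      = siteVec N k + (2 : ℂ) • (siteVec N (Equiv.swap (n : ℕ) (n + 1) k) - siteVec N k) := by
  funext s
  rw [pauli_sum_mulVec (leftSite_ne_rightSite n)]
  have : siteVec N k (s ∘ Equiv.swap (leftSite n) (rightSite n))
      = siteVec N (Equiv.swap (n : ℕ) (n + 1) k) s := by
    simp only [siteVec, Pi.single_apply, ← siteConfig_comp_swap]
    congr 1
    refine propext ⟨fun h => ?_, fun h => ?_⟩
    · rw [← h]; funext m; simp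
    · rw [h]; funext m; simp
  rw [this]
  simp
  ring

lemma sum_pauliZ_mulVec_siteVec {k : ℕ} (hk : k < N) :
    (∑ n : Fin N, onSite pauliZ n) *ᵥ siteVec N k = ((N : ℂ) - 2) • siteVec N k := by
  have hZ : ∀ n : Fin N, onSite pauliZ n *ᵥ siteVec N k
      = (1 - if n = ⟨k, hk⟩ then 2 else 0 : ℂ) • siteVec N k := by
    intro n
    funext s
    rw [onSite_mulVec, Fin.sum_univ_two]
    by_cases hs : s = siteConfig N k
    · subst hs
      by_cases hn : n = ⟨k, hk⟩
      · subst hn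
        have h1 : siteConfig N k ⟨k, hk⟩ = 1 := by simp [siteConfig]
        have h2 := Function.update_eq_self (⟨k, hk⟩ : Fin N) (siteConfig N k)
        rw [h1] at h2
        rw [h1, h2]
        simp [pauliZ]
        norm_num
      · have h1 : siteConfig N k n = 0 := by
          simpa [siteConfig, Fin.ext_iff] using hn
        have h2 := Function.update_eq_self n (siteConfig N k)
        rw [h1] at h2
        rw [h1, h2]
        simp [pauliZ, hn]
    · have h2 := Function.update_eq_self n s
      have h3 : siteVec N k s = 0 := by simp [siteVec, hs]
      have h4 : ∀ x : Fin 2, x = 0 ∨ x = 1 := by decide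
      rcases h4 (s n) with h | h <;> rw [h] at h2 <;> simp [pauliZ, h, h2, h3]
  rw [sum_mulVec, Finset.sum_congr rfl fun n _ => hZ n, ← Finset.sum_smul]
  simp

/-- The coupling between the sites `k - 1` and `k`, zero if one of them is not in the chain. -/
def coupling (J : Fin (N - 1) → ℝ) (k : ℕ) : ℝ :=
  if h : 0 < k ∧ k < N then J ⟨k - 1, by omega⟩ else 0

lemma coupling_zero (J : Fin (N - 1) → ℝ) : coupling J 0 = 0 := by simp [coupling]

lemma coupling_length (J : Fin (N - 1) → ℝ) : coupling J N = 0 := by simp [coupling]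

lemma coupling_pos {J : Fin (N - 1) → ℝ} (hJ : ∀ n, 0 < J n) {k : ℕ} (h0 : 0 < k) (hk : k < N) :
    0 < coupling J k := by
  rw [coupling, dif_pos ⟨h0, hk⟩]
  exact hJ _

lemma coupling_succ (J : Fin (N - 1) → ℝ) (n : Fin (N - 1)) : coupling J (n + 1) = J n := by
  rw [coupling, dif_pos ⟨by omega, by omega⟩]
  rfl

/-- Only the links on either side of site `k` move the excitation. At the ends, the meaningless
neighbours `k - 1` (truncated) and `N` carry zero coupling. -/
lemma heisenbergHamiltonian_mulVec_siteVec (J : Fin (N - 1) → ℝ) (b : ℝ) {k : ℕ} (hk : k < N) :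
    heisenbergHamiltonian N J (fun _ => b) *ᵥ siteVec N k
      = ((∑ n, J n + b * (N - 2) : ℝ) : ℂ) • siteVec N k
        + (2 * coupling J k : ℂ) • (siteVec N (k - 1) - siteVec N k)
        + (2 * coupling J (k + 1) : ℂ) • (siteVec N (k + 1) - siteVec N k) := by
  have hH : heisenbergHamiltonian N J (fun _ => b)
      = ∑ n : Fin (N - 1), (J n : ℂ) •
        (onSite pauliX (leftSite n) * onSite pauliX (rightSite n)
          + onSite pauliY (leftSite n) * onSite pauliY (rightSite n)
          + onSite pauliZ (leftSite n) * onSite pauliZ (rightSite n))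
        + (b : ℂ) • ∑ n : Fin N, onSite pauliZ n := by
    simp only [heisenbergHamiltonian, exchangeHamiltonian, smul_add, Finset.sum_add_distrib,
      Finset.smul_sum]
    abel
  have hlink : ∑ n : Fin (N - 1), (J n : ℂ) •
      ((2 : ℂ) • (siteVec N (Equiv.swap (n : ℕ) (n + 1) k) - siteVec N k))
      = (2 * coupling J k : ℂ) • (siteVec N (k - 1) - siteVec N k)
        + (2 * coupling J (k + 1) : ℂ) • (siteVec N (k + 1) - siteVec N k) := by
    have hterm : ∀ n : Fin (N - 1), (J n : ℂ) •
        ((2 : ℂ) • (siteVec N (Equiv.swap (n : ℕ) (n + 1) k) - siteVec N k))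
        = (if (n : ℕ) + 1 = k then
            (2 * coupling J k : ℂ) • (siteVec N (k - 1) - siteVec N k) else 0)
          + if (n : ℕ) = k then
            (2 * coupling J (k + 1) : ℂ) • (siteVec N (k + 1) - siteVec N k) else 0 := by
      intro n
      rw [smul_smul, mul_comm, ← coupling_succ J n]
      by_cases h1 : (n : ℕ) + 1 = k
      · subst h1; simp
      · by_cases h2 : (n : ℕ) = k
        · subst h2; simp
        · rw [Equiv.swap_apply_of_ne_of_ne (Ne.symm h2) (Ne.symm h1)]
          simp [h1, h2]
    rw [Finset.sum_congr rfl fun n _ => hterm n, Finset.sum_add_distrib]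
    congr 1
    · rcases Nat.eq_zero_or_pos k with rfl | h0
      · simp [coupling_zero]
      · rw [Finset.sum_eq_single ⟨k - 1, by omega⟩]
        · rw [if_pos (by simp; omega)]
        · intro n _ hn
          exact if_neg fun h => hn (Fin.ext (by simp; omega))
        · simp
    · rcases Nat.lt_or_ge (k + 1) N with h0 | h0
      · rw [Finset.sum_eq_single ⟨k, by omega⟩]
        · rw [if_pos rfl]
        · intro n _ hn
          exact if_neg fun h => hn (Fin.ext h)
        · simp
      · have : k + 1 = N := by omega
        simp [this, coupling_length]
  rw [hH, add_mulVec, sum_mulVec, smul_mulVec, sum_pauliZ_mulVec_siteVec hk]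
  simp only [smul_mulVec, link_mulVec_siteVec]
  simp only [smul_add (_ : ℂ) (siteVec N k) _, Finset.sum_add_distrib]
  rw [hlink, ← Finset.sum_smul]
  push_cast
  module

/-- Summation by parts for a weighted path Laplacian. -/
lemma sum_smul_laplacian {V : Type*} [AddCommGroup V] [Module ℂ V] (G w : ℕ → ℂ) (e : ℕ → V)
    (hG : G 0 = 0) (n : ℕ) :
    ∑ k ∈ Finset.range n, w k • (G k • (e (k - 1) - e k) + G (k + 1) • (e (k + 1) - e k))
      = ∑ k ∈ Finset.range n,
          (G k * (w (k - 1) - w k) + G (k + 1) * (w (k + 1) - w k)) • e k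
        + G n • (w (n - 1) • e n - w n • e (n - 1)) := by
  induction n with
  | zero => simp [hG]
  | succ n ih =>
    rw [Finset.sum_range_succ, Finset.sum_range_succ, ih, Nat.add_sub_cancel]
    module

/-- Summation by parts moves the Laplacian from the site vectors to the amplitudes; the boundary
term vanishes with `coupling J N`. -/
lemma heisenbergHamiltonian_mulVec_sum {J : Fin (N - 1) → ℝ} {b : ℝ} {w : ℕ → ℂ} {x : ℂ}
    (hw : ∀ k < N, coupling J k * (w (k - 1) - w k) + coupling J (k + 1) * (w (k + 1) - w k)
      = x * w k) :
    heisenbergHamiltonian N J (fun _ => b) *ᵥ (∑ k ∈ Finset.range N, w k • siteVec N k)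
      = (((∑ n, J n + b * (N - 2) : ℝ) : ℂ) + 2 * x) •
        ∑ k ∈ Finset.range N, w k • siteVec N k := by
  have h1 := sum_smul_laplacian (fun k => (coupling J k : ℂ)) w (siteVec N)
    (by simp [coupling_zero]) N
  simp only [coupling_length, Complex.ofReal_zero, zero_smul, add_zero] at h1
  have h2 : ∑ k ∈ Finset.range N,
      (coupling J k * (w (k - 1) - w k) + coupling J (k + 1) * (w (k + 1) - w k)) • siteVec N k
      = x • ∑ k ∈ Finset.range N, w k • siteVec N k := by
    rw [Finset.smul_sum]
    refine Finset.sum_congr rfl fun k hk => ?_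
    rw [hw k (Finset.mem_range.1 hk), mul_smul]
  rw [mulVec_sum, add_smul, mul_smul, ← h2, ← h1, Finset.smul_sum, Finset.smul_sum,
    ← Finset.sum_add_distrib]
  refine Finset.sum_congr rfl fun k hk => ?_
  rw [mulVec_smul, heisenbergHamiltonian_mulVec_siteVec J b (Finset.mem_range.1 hk)]
  module

lemma evolution_mulVec_sum {J : Fin (N - 1) → ℝ} {b : ℝ} {w : ℕ → ℂ} {x : ℂ} (t : ℝ)
    (hw : ∀ k < N, coupling J k * (w (k - 1) - w k) + coupling J (k + 1) * (w (k + 1) - w k)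
      = x * w k) :
    evolution (heisenbergHamiltonian N J (fun _ => b)) t *ᵥ
        (∑ k ∈ Finset.range N, w k • siteVec N k)
      = Complex.exp (-(Complex.I * t) * (((∑ n, J n + b * (N - 2) : ℝ) : ℂ) + 2 * x)) •
        ∑ k ∈ Finset.range N, w k • siteVec N k := by
  refine exp_mulVec_of_mulVec_eq_smul ?_
  rw [smul_mulVec, heisenbergHamiltonian_mulVec_sum hw, smul_smul]

lemma sum_smul_siteVec_apply (w : ℕ → ℂ) {k : ℕ} (hk : k < N) :
    (∑ l ∈ Finset.range N, w l • siteVec N l) (siteConfig N k) = w k := by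
  rw [Finset.sum_apply, Finset.sum_eq_single k]
  · simp [siteVec]
  · intro l _ hl
    simp [siteVec, siteConfig_inj hk, hl.symm]
  · simp [hk]

/-! ### Transfer forces mirror symmetry. -/

lemma norm_sq_eq_of_unitary {ι : Type*} [Fintype ι] [DecidableEq ι] {U : Matrix ι ι ℂ}
    (hU : Uᴴ * U = 1) (v : ι → ℂ) : star (U *ᵥ v) ⬝ᵥ (U *ᵥ v) = star v ⬝ᵥ v := by
  rw [star_mulVec, dotProduct_mulVec, vecMul_vecMul, hU, vecMul_one]

lemma star_dotProduct_siteVec {k l : ℕ} (hk : k < N) :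
    star (siteVec N k) ⬝ᵥ siteVec N l = if k = l then 1 else 0 := by
  simp [siteVec, Pi.single_apply, eq_comm (a := siteConfig N l), siteConfig_inj hk]

/-- A unit vector that is an affine combination, with nonzero weight, of one of two orthonormal
vectors is that vector. -/
lemma eq_one_of_norm_affine_comb {k l : ℕ} (hk : k < N) (hl : l < N) (hkl : k ≠ l) {q : ℂ}
    (hq : star q * q = 1) {r : ℝ} (hr : r ≠ 0)
    (h : star (q • (siteVec N k + (r : ℂ) • (siteVec N l - siteVec N k))) ⬝ᵥ
      (q • (siteVec N k + (r : ℂ) • (siteVec N l - siteVec N k))) = 1) : r = 1 := by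
  simp only [star_smul, star_add, star_sub, smul_dotProduct, dotProduct_smul, add_dotProduct,
    dotProduct_add, sub_dotProduct, dotProduct_sub, star_dotProduct_siteVec hk,
    star_dotProduct_siteVec hl, if_neg hkl, if_neg hkl.symm, smul_eq_mul, if_true,
    Complex.star_def, Complex.conj_ofReal] at h hq
  -- The norm condition is `(1 - r) ^ 2 + r ^ 2 = 1`.
  have h2 : (r : ℂ) * (r - 1) = 0 := by
    linear_combination (1 / 2 : ℂ) * h - (1 / 2 : ℂ) * ((1 - r) ^ 2 + r ^ 2) * hq
  have h3 : r * (r - 1) = 0 := by exact_mod_cast h2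
  rcases mul_eq_zero.1 h3 with h4 | h4
  · exact absurd h4 hr
  · linarith

/-- End-to-end transfer forces the evolution to mirror every site, and the chain to be
mirror symmetric. -/
lemma mirror_of_transfer {J : Fin (N - 1) → ℝ} (hJ : ∀ n, 0 < J n) (b t : ℝ) {q : ℂ}
    (hq : star q * q = 1)
    (h0 : evolution (heisenbergHamiltonian N J (fun _ => b)) t *ᵥ siteVec N 0
      = q • siteVec N (N - 1)) (k : ℕ) (hk : k < N) :
    evolution (heisenbergHamiltonian N J (fun _ => b)) t *ᵥ siteVec N k
      = q • siteVec N (N - 1 - k) ∧ coupling J k = coupling J (N - k) := by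
  induction k using Nat.strong_induction_on with
  | _ k ih =>
  rcases k with _ | k
  · exact ⟨by simpa using h0, by simp [coupling_zero, coupling_length]⟩
  set H := heisenbergHamiltonian N J (fun _ => b) with hH
  set U := evolution H t with hU
  obtain ⟨ih1, ih2⟩ := ih k (by omega) (by omega)
  -- The factor `coupling J k` covers `k = 0`, where there is no previous site.
  have hprev : (coupling J k : ℂ) • (U *ᵥ siteVec N (k - 1))
      = (coupling J k : ℂ) • q • siteVec N (N - k) := by
    rcases k with _ | k
    · simp [coupling_zero]
    · rw [Nat.add_sub_cancel, (ih k (by omega) (by omega)).1]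
      congr 3
      omega
  -- Site `l` is the mirror image of site `k + 1`.
  obtain ⟨l, hl⟩ : ∃ l, N - 1 - k = l + 1 := ⟨N - 2 - k, by omega⟩
  have e1 : N - k = l + 2 := by omega
  have e2 : N - 1 - (k + 1) = l := by omega
  have e3 : N - (k + 1) = l + 1 := by omega
  rw [hl] at ih1
  rw [e1] at ih2 hprev
  rw [e2, e3]
  -- Expanded at site `k`, this leaves the image of site `k + 1` as the only unknown.
  have hcomm : U *ᵥ (H *ᵥ siteVec N k) = H *ᵥ (U *ᵥ siteVec N k) := by
    rw [mulVec_mulVec, mulVec_mulVec, hU, evolution_mul_comm]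
  rw [ih1, mulVec_smul, hH, heisenbergHamiltonian_mulVec_siteVec J b (by omega),
    heisenbergHamiltonian_mulVec_siteVec J b (by omega), mulVec_add, mulVec_add, mulVec_smul,
    mulVec_smul, mulVec_smul, mulVec_sub, mulVec_sub, ih1, Nat.add_sub_cancel, ← ih2] at hcomm
  have hk1 : 0 < coupling J (k + 1) := coupling_pos hJ (by omega) (by omega)
  have hl1 : 0 < coupling J (l + 1) := coupling_pos hJ (by omega) (by omega)
  have hk1' : (coupling J (k + 1) : ℂ) ≠ 0 := by exact_mod_cast hk1.ne'
  have hstep : (coupling J (k + 1) : ℂ) • (U *ᵥ siteVec N (k + 1) - q • siteVec N (l + 1))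
      = (coupling J (l + 1) : ℂ) • q • (siteVec N l - siteVec N (l + 1)) := by
    have h2 : (2 : ℂ) ≠ 0 := two_ne_zero
    refine smul_right_injective _ h2 ?_
    simp only
    linear_combination (norm := module) hcomm - (2 : ℂ) • hprev
  set r := coupling J (l + 1) / coupling J (k + 1) with hr
  have hUk : U *ᵥ siteVec N (k + 1)
      = q • (siteVec N (l + 1) + (r : ℂ) • (siteVec N l - siteVec N (l + 1))) := by
    refine smul_right_injective _ hk1' ?_
    have hrc : (coupling J (l + 1) : ℂ) = coupling J (k + 1) * r := by
      rw [hr]; push_cast; field_simp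
    rw [hrc] at hstep
    simp only
    linear_combination (norm := module) hstep
  -- Unitarity leaves `r = 0` or `r = 1`, and positive couplings exclude `0`.
  have hnorm := norm_sq_eq_of_unitary
    (evolution_conjTranspose_mul_self (isHermitian_heisenbergHamiltonian J fun _ => b) t) (siteVec N (k + 1))
  rw [← hH, ← hU, hUk, star_dotProduct_siteVec hk, if_pos rfl] at hnorm
  have hr1 : r = 1 := eq_one_of_norm_affine_comb (by omega) (by omega) (by omega) hq
    (div_pos hl1 hk1).ne' hnorm
  refine ⟨?_, ?_⟩
  · rw [hUk, hr1]
    simp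
  · rw [hr, div_eq_one_iff_eq hk1.ne'] at hr1
    exact hr1.symm

/-! ### Phases of symmetric and antisymmetric eigenvectors. -/

/-- The eigenvalue phases of mirror-(anti)symmetric eigenvectors under a mirroring evolution. -/
lemma exp_eq_of_mirror {J : Fin (N - 1) → ℝ} {b t : ℝ} {q : ℂ} (hN : 0 < N)
    (hU : ∀ k < N, evolution (heisenbergHamiltonian N J (fun _ => b)) t *ᵥ siteVec N k
      = q • siteVec N (N - 1 - k)) {w : ℕ → ℂ} {x ε : ℂ} (hw0 : w 0 = 1)
    (hε : ∀ k < N, w (N - 1 - k) = ε * w k)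
    (hw : ∀ k < N, coupling J k * (w (k - 1) - w k) + coupling J (k + 1) * (w (k + 1) - w k)
      = x * w k) :
    Complex.exp (-(Complex.I * t) * (((∑ n, J n + b * (N - 2) : ℝ) : ℂ) + 2 * x)) = q * ε := by
  have h1 := evolution_mulVec_sum (b := b) t hw
  have h2 : evolution (heisenbergHamiltonian N J (fun _ => b)) t *ᵥ
      (∑ k ∈ Finset.range N, w k • siteVec N k)
      = (q * ε) • ∑ k ∈ Finset.range N, w k • siteVec N k := by
    rw [mulVec_sum, ← Finset.sum_range_reflect, Finset.smul_sum]
    refine Finset.sum_congr rfl fun k hk => ?_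
    have hk' := Finset.mem_range.1 hk
    rw [mulVec_smul, hU _ (by omega), hε k hk', smul_smul, smul_smul]
    congr 1
    · ring
    · congr 1
      omega
  rw [h1] at h2
  have h3 := congrFun h2 (siteConfig N 0)
  simpa only [Pi.smul_apply, sum_smul_siteVec_apply w hN, hw0, smul_eq_mul, mul_one] using h3

/-- The eigenvalue phase of a vector obtained by mirroring amplitudes on the left half. -/
lemma exp_eq_of_half {J : Fin (N - 1) → ℝ} {b t : ℝ} {q : ℂ} (hN : 2 ≤ N)
    (hU : ∀ k < N, evolution (heisenbergHamiltonian N J (fun _ => b)) t *ᵥ siteVec N k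
      = q • siteVec N (N - 1 - k)) (hG : ∀ k < N, coupling J k = coupling J (N - k))
    {u : ℕ → ℂ} {x ε : ℂ} (hε : ε * ε = 1) (hu0 : u 0 = 1)
    (h1 : ∀ k, 2 * k + 3 ≤ N →
      coupling J k * (u (k - 1) - u k) + coupling J (k + 1) * (u (k + 1) - u k) = x * u k)
    (h2 : ∀ k, N = 2 * k + 2 →
      coupling J k * (u (k - 1) - u k) + coupling J (k + 1) * (ε * u k - u k) = x * u k)
    (h3 : ∀ k, N = 2 * k + 1 → ε * u k = u k ∧
      coupling J k * (u (k - 1) - u k) + coupling J k * (ε * u (k - 1) - u k) = x * u k) :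
    Complex.exp (-(2 * Complex.I * t * x)) = ε := by
  -- The constant vector has phase `q`; dividing by it removes both `q` and the energy offset.
  have hconst := exp_eq_of_mirror (J := J) (b := b) (t := t) (q := q) (w := fun _ => 1) (x := 0)
    (ε := 1) (by omega) hU rfl (by simp) (by simp)
  set w : ℕ → ℂ := fun k => if 2 * k + 1 ≤ N then u k else ε * u (N - 1 - k) with hw
  have wl : ∀ k, 2 * k + 1 ≤ N → w k = u k := fun k hk => if_pos hk
  have wr : ∀ k, N < 2 * k + 1 → w k = ε * u (N - 1 - k) := fun k hk => if_neg (by omega)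
  have hmirror : ∀ k < N, w (N - 1 - k) = ε * w k := by
    intro k hk
    rcases lt_trichotomy (2 * k + 1) N with h | h | h
    · rw [wl k h.le, wr _ (by omega)]
      congr 2
      omega
    · have e : N - 1 - k = k := by omega
      rw [e, wl k h.le]
      exact (h3 k h.symm).1.symm
    · rw [wr k h, wl _ (by omega), ← mul_assoc, hε, one_mul]
  have hleft : ∀ k, 2 * k + 1 ≤ N →
      coupling J k * (w (k - 1) - w k) + coupling J (k + 1) * (w (k + 1) - w k) = x * w k := by
    intro k hk
    rw [wl k hk, wl (k - 1) (by omega)]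
    rcases (by omega : 2 * k + 3 ≤ N ∨ N = 2 * k + 2 ∨ N = 2 * k + 1) with h | h | h
    · rw [wl (k + 1) (by omega), h1 k h]
    · rw [wr (k + 1) (by omega)]
      have e : N - 1 - (k + 1) = k := by omega
      rw [e, h2 k h]
    · rw [wr (k + 1) (by omega), hG (k + 1) (by omega)]
      have e : N - 1 - (k + 1) = k - 1 := by omega
      have e' : N - (k + 1) = k := by omega
      rw [e, e', (h3 k h).2]
  have heig := exp_eq_of_mirror (J := J) (b := b) (t := t) (q := q) (w := w) (x := x)
    (ε := ε) (by omega) hU (by rw [wl 0 (by omega), hu0]) hmirror (by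
      intro k hk
      rcases Nat.lt_or_ge N (2 * k + 1) with h | h
      · have hm := hleft (N - 1 - k) (by omega)
        rw [hmirror k hk] at hm
        -- The coupling stays as a factor because for `k + 1 = N` the index truncates and the
        -- coupling is zero.
        have hp : (coupling J (k + 1) : ℂ) * w (N - 1 - k - 1)
            = coupling J (k + 1) * (ε * w (k + 1)) := by
          rcases Nat.lt_or_ge (k + 1) N with h' | h'
          · rw [← hmirror (k + 1) h']
            congr 2
          · have : k + 1 = N := by omega
            simp [this, coupling_length]
        have hn : w (N - 1 - k + 1) = ε * w (k - 1) := by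
          rw [← hmirror (k - 1) (by omega)]
          congr 1
          omega
        have c1 : coupling J (N - 1 - k + 1) = coupling J k := by
          rw [hG k hk]
          congr 1
          omega
        have c2 : coupling J (N - 1 - k) = coupling J (k + 1) := by
          rcases Nat.lt_or_ge (k + 1) N with h' | h'
          · rw [hG (k + 1) h']
            congr 1
            omega
          · have : k + 1 = N := by omega
            rw [this, coupling_length, (by omega : N - 1 - k = 0), coupling_zero]
        rw [hn, c1, c2] at hm
        linear_combination ε * hm - ε * hp + (x * w k - coupling J k * (w (k - 1) - w k)
          - coupling J (k + 1) * (w (k + 1) - w k)) * hε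
      · exact hleft k h)
  rw [mul_zero, add_zero, mul_one] at hconst
  rw [mul_add, Complex.exp_add, hconst] at heig
  have hq : q ≠ 0 := hconst ▸ Complex.exp_ne_zero _
  rw [← mul_left_cancel₀ hq heig]
  congr 1
  ring

/-! ### Half-chain solutions and integrality of the rescaled eigenvalues. -/

/-- The couplings of the chain in the unit of energy `π / (2 t)`. -/
def scaledCoupling (J : Fin (N - 1) → ℝ) (t : ℝ) (k : ℕ) : ℂ :=
  2 * t / Real.pi * coupling J (k + 1)

/-- The amplitude at site `k` of the solution of the eigenvalue recurrence starting from `1`. -/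
def halfAmplitude (j : ℕ → ℂ) (y : ℂ) (k : ℕ) : ℂ :=
  (amplitude j k).eval y / ∏ i ∈ Finset.range k, j i

/-- The sum of the amplitudes at the sites `0, …, k`. -/
def halfSum (j : ℕ → ℂ) (y : ℂ) (k : ℕ) : ℂ :=
  (amplitudeSum j k).eval y / ∏ i ∈ Finset.range k, j i

lemma halfAmplitude_zero (j : ℕ → ℂ) (y : ℂ) : halfAmplitude j y 0 = 1 := by
  simp [halfAmplitude, amplitude_zero]

lemma halfSum_zero (j : ℕ → ℂ) (y : ℂ) : halfSum j y 0 = 1 := by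
  simp [halfSum, amplitudeSum_zero]

/-- The eigenvalue equations at sites `0, …, k` telescope: the flow through the link after `k`
balances `y` times the total amplitude up to `k`. -/
lemma halfAmplitude_succ {j : ℕ → ℂ} {k : ℕ} (hj : j k ≠ 0) (y : ℂ) :
    j k * (halfAmplitude j y (k + 1) - halfAmplitude j y k) = y * halfSum j y k := by
  rw [halfAmplitude, halfAmplitude, halfSum, Finset.prod_range_succ, amplitude_succ]
  by_cases h : ∏ i ∈ Finset.range k, j i = 0
  · simp [h]
  · simp only [eval_add, eval_mul, eval_C, eval_X]
    field_simp
    ring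

lemma halfSum_succ {j : ℕ → ℂ} {k : ℕ} (hj : j k ≠ 0) (y : ℂ) :
    halfSum j y (k + 1) = halfSum j y k + halfAmplitude j y (k + 1) := by
  rw [halfAmplitude, halfSum, halfSum, Finset.prod_range_succ, amplitudeSum_succ]
  by_cases h : ∏ i ∈ Finset.range k, j i = 0
  · simp [h]
  · simp only [eval_add, eval_mul, eval_C]
    field_simp

/-- A real-time phase `exp (-iπy) = ±1` forces `y` to be an even, respectively odd, integer. -/
lemma exists_even_of_exp_eq_one {y : ℂ} (h : Complex.exp (-(Complex.I * Real.pi * y)) = 1) :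
    ∃ k : ℤ, Even k ∧ y = k := by
  obtain ⟨n, hn⟩ := Complex.exp_eq_one_iff.1 h
  refine ⟨-(2 * n), (even_two_mul n).neg, ?_⟩
  have h0 : Complex.I * Real.pi ≠ 0 :=
    mul_ne_zero Complex.I_ne_zero (by exact_mod_cast Real.pi_ne_zero)
  apply mul_left_cancel₀ h0
  push_cast
  linear_combination -hn

lemma exists_odd_of_exp_eq_neg_one {y : ℂ}
    (h : Complex.exp (-(Complex.I * Real.pi * y)) = -1) : ∃ k : ℤ, Odd k ∧ y = k := by
  obtain ⟨k, hk, hy⟩ := exists_even_of_exp_eq_one (y := y + 1) (by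
    rw [(by ring : -(Complex.I * Real.pi * (y + 1))
      = -(Complex.I * Real.pi * y) + -(Real.pi * Complex.I)), Complex.exp_add, h,
      Complex.exp_neg, Complex.exp_pi_mul_I]
    norm_num)
  refine ⟨k - 1, hk.sub_odd odd_one, ?_⟩
  push_cast
  linear_combination hy

/-- A root of the half-chain boundary condition of parity `ε` has phase `ε`. -/
lemma exp_eq_of_half_root {J : Fin (N - 1) → ℝ} (hJ : ∀ n, 0 < J n) {b t : ℝ} (ht : 0 < t)
    {q : ℂ} (hN : 2 ≤ N)
    (hU : ∀ k < N, evolution (heisenbergHamiltonian N J (fun _ => b)) t *ᵥ siteVec N k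
      = q • siteVec N (N - 1 - k)) (hG : ∀ k < N, coupling J k = coupling J (N - k))
    {y ε : ℂ} (hε : ε * ε = 1)
    (heven : ∀ k, N = 2 * k + 2 → scaledCoupling J t k *
        ((ε - 1) * halfAmplitude (scaledCoupling J t) y k)
      = y * halfSum (scaledCoupling J t) y k)
    (hodd : ∀ k, N = 2 * k + 3 →
      ε * halfAmplitude (scaledCoupling J t) y (k + 1)
        = halfAmplitude (scaledCoupling J t) y (k + 1) ∧
      scaledCoupling J t k * ((1 + ε) * halfAmplitude (scaledCoupling J t) y k
          - 2 * halfAmplitude (scaledCoupling J t) y (k + 1))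
        = y * halfAmplitude (scaledCoupling J t) y (k + 1)) :
    Complex.exp (-(Complex.I * Real.pi * y)) = ε := by
  set j := scaledCoupling J t with hj
  set a : ℂ := 2 * t / Real.pi with ha
  have hpi : (Real.pi : ℂ) ≠ 0 := by exact_mod_cast Real.pi_ne_zero
  have ht' : (t : ℂ) ≠ 0 := by exact_mod_cast ht.ne'
  have ha0 : a ≠ 0 := div_ne_zero (mul_ne_zero two_ne_zero ht') hpi
  have hjG : ∀ k, j k = a * coupling J (k + 1) := fun k => rfl
  have hj0 : ∀ k, k + 1 < N → j k ≠ 0 := fun k hk => by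
    rw [hjG]
    exact mul_ne_zero ha0 (by exact_mod_cast (coupling_pos hJ (by omega) hk).ne')
  have hfwd : ∀ k, k + 1 < N → a * (coupling J (k + 1)
      * (halfAmplitude j y (k + 1) - halfAmplitude j y k)) = y * halfSum j y k := by
    intro k hk
    rw [← halfAmplitude_succ (hj0 k hk), hjG]
    ring
  have hbwd : ∀ k, k < N → a * (coupling J k
      * (halfAmplitude j y (k - 1) - halfAmplitude j y k))
      = y * (halfAmplitude j y k - halfSum j y k) := by
    intro k hk
    rcases k with _ | k
    · simp [coupling_zero, halfAmplitude_zero, halfSum_zero]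
    · rw [Nat.add_sub_cancel, halfSum_succ (hj0 k hk)]
      linear_combination -hfwd k hk
  -- The unscaled Laplacian eigenvalue is `y / a`.
  have hy : Complex.I * Real.pi * y = 2 * Complex.I * t * (y / a) := by
    rw [ha]
    field_simp
  rw [hy]
  refine exp_eq_of_half (u := halfAmplitude j y) hN hU hG hε (halfAmplitude_zero j y) ?_ ?_ ?_
  · intro k hk
    apply mul_left_cancel₀ ha0
    rw [← mul_assoc a (y / a), mul_div_cancel₀ _ ha0]
    linear_combination hbwd k (by omega) + hfwd k (by omega)
  · intro k hk
    apply mul_left_cancel₀ ha0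
    rw [← mul_assoc a (y / a), mul_div_cancel₀ _ ha0]
    have h := heven k hk
    rw [hjG] at h
    linear_combination hbwd k (by omega) + h
  · intro k hk
    obtain ⟨l, rfl⟩ : ∃ l, k = l + 1 := ⟨k - 1, by omega⟩
    obtain ⟨h1, h2⟩ := hodd l (by omega)
    refine ⟨h1, ?_⟩
    apply mul_left_cancel₀ ha0
    rw [← mul_assoc a (y / a), mul_div_cancel₀ _ ha0]
    rw [hjG] at h2
    rw [Nat.add_sub_cancel]
    linear_combination h2

/-! ### The two directions of the equivalence. -/

/-- A chain of at least three sites has no end-to-end perfect state transfer. -/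
lemma length_eq_two_of_transfer (hN : 2 ≤ N) {J : Fin (N - 1) → ℝ} (hJ : ∀ n, 0 < J n)
    {b t : ℝ} (ht : 0 < t) {q : ℂ} (hq : star q * q = 1)
    (h0 : evolution (heisenbergHamiltonian N J (fun _ => b)) t *ᵥ siteVec N 0
      = q • siteVec N (N - 1)) : N = 2 := by
  by_contra hne
  have hU := fun k hk => (mirror_of_transfer hJ b t hq h0 k hk).1
  have hG := fun k hk => (mirror_of_transfer hJ b t hq h0 k hk).2
  have hj0 : ∀ k, k + 1 < N → scaledCoupling J t k ≠ 0 := fun k hk => by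
    have h1 : (2 * t / Real.pi * coupling J (k + 1) : ℝ) ≠ 0 :=
      mul_ne_zero (by positivity) (coupling_pos hJ (by omega) hk).ne'
    unfold scaledCoupling
    exact_mod_cast h1
  rcases Nat.even_or_odd' N with ⟨n, hn | hn⟩
  · obtain ⟨m, rfl⟩ : ∃ m, n = m + 2 := ⟨n - 2, by omega⟩
    refine false_of_roots_even_length (scaledCoupling J t) m (fun y hy => ?_) (fun y hy => ?_)
    · refine exists_odd_of_exp_eq_neg_one
        (exp_eq_of_half_root hJ ht hN hU hG (by norm_num) (fun k hk => ?_) (by omega))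
      obtain rfl : k = m + 1 := by omega
      simp only [eval_add, eval_mul, eval_C, eval_X] at hy
      rw [halfAmplitude, halfSum]
      linear_combination (-1 / ∏ i ∈ Finset.range (m + 1), scaledCoupling J t i) * hy
    · refine exists_even_of_exp_eq_one
        (exp_eq_of_half_root hJ ht hN hU hG (by norm_num) (fun k hk => ?_) (by omega))
      obtain rfl : k = m + 1 := by omega
      -- The symmetric condition is `y * halfSum = 0`; its factor `y`, from the constant
      -- eigenvector, is absent from the polynomial.
      simp [halfSum, hy]
  · obtain ⟨m, rfl⟩ : ∃ m, n = m + 1 := ⟨n - 1, by omega⟩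
    refine false_of_roots_odd_length (scaledCoupling J t) m (fun y hy => ?_) (fun y hy => ?_)
    · refine exists_odd_of_exp_eq_neg_one
        (exp_eq_of_half_root hJ ht hN hU hG (by norm_num) (by omega) (fun k hk => ?_))
      obtain rfl : k = m := by omega
      simp [halfAmplitude, hy]
    · refine exists_even_of_exp_eq_one
        (exp_eq_of_half_root hJ ht hN hU hG (by norm_num) (by omega) (fun k hk => ?_))
      obtain rfl : k = m := by omega
      refine ⟨one_mul _, ?_⟩
      have hs := halfAmplitude_succ (hj0 k (by omega)) y
      -- The amplitudes over the whole chain sum to zero; the equation at the central site is `y`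
      -- times this one.
      have hroot : 2 * halfSum (scaledCoupling J t) y k
          + halfAmplitude (scaledCoupling J t) y (k + 1) = 0 := by
        have hjk := hj0 k (by omega)
        simp only [eval_add, eval_mul, eval_C] at hy
        rw [halfAmplitude, halfSum, Finset.prod_range_succ,
          ← mul_div_mul_right _ _ hjk, ← mul_div_assoc, ← add_div]
        rw [div_eq_zero_iff]
        left
        linear_combination hy
      linear_combination -2 * hs - y * hroot

/-- A chain of two sites transfers its excitation at time `π / (4 J)`. -/
lemma transfer_of_length_two {J : Fin (2 - 1) → ℝ} (hJ : ∀ n, 0 < J n) (b : ℝ) :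
    evolution (heisenbergHamiltonian 2 J (fun _ => b)) (Real.pi / (4 * J 0)) *ᵥ siteVec 2 0
      = Complex.exp (Complex.I * (-(Real.pi / (4 * J 0) * ∑ n, J n) : ℝ)) • siteVec 2 1 := by
  have hJ0 : (J 0 : ℂ) ≠ 0 := by exact_mod_cast (hJ 0).ne'
  have hc1 : coupling J 1 = J 0 := coupling_succ J 0
  have hc0 : coupling J 0 = 0 := coupling_zero J
  have hc2 : coupling J 2 = 0 := coupling_length J
  set t : ℝ := Real.pi / (4 * J 0) with ht
  -- The eigenvectors `(1, 1)` and `(1, -1)` have energies differing by `4 * J 0`, so at this `t`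
  -- their phases differ by `π`.
  have hp := evolution_mulVec_sum (J := J) (b := b) (w := fun _ => 1) (x := 0) t (by simp)
  have hm := evolution_mulVec_sum (J := J) (b := b) (w := fun k => (-1) ^ k) (x := -2 * J 0) t (by
    intro k hk
    interval_cases k
    · simp [hc0, hc1]; ring
    · simp [hc1, hc2]; ring)
  simp only [Finset.sum_range_succ, Finset.range_zero, Finset.sum_empty, zero_add, pow_zero,
    pow_one, one_smul, mul_zero, add_zero] at hp hm
  set c : ℝ := ∑ n, J n with hcdef
  -- With one of two spins flipped, the field contributes nothing.
  have hcc : (c + b * ((2 : ℕ) - 2) : ℝ) = c := by push_cast; ring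
  rw [hcc] at hp hm
  have hphase : Complex.exp (-(Complex.I * t) * (c + 2 * (-2 * J 0)))
      = -Complex.exp (-(Complex.I * t) * c) := by
    have : -(Complex.I * (t : ℂ)) * (c + 2 * (-2 * J 0))
        = -(Complex.I * t) * c + Real.pi * Complex.I := by
      rw [ht]
      push_cast
      field_simp
      ring
    rw [this, Complex.exp_add, Complex.exp_pi_mul_I, mul_neg_one]
  rw [hphase] at hm
  have hexp : Complex.exp (Complex.I * (-(t * c) : ℝ)) = Complex.exp (-(Complex.I * t) * c) := by
    congr 1
    push_cast
    ring
  rw [hexp]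
  have hsplit : siteVec 2 0 = (1 / 2 : ℂ) • ((siteVec 2 0 + siteVec 2 1)
      + (siteVec 2 0 + (-1 : ℂ) • siteVec 2 1)) := by module
  rw [hsplit, mulVec_smul, mulVec_add, hp, hm]
  module

end SpinChain

end

theorem mainTheorem1 (N : ℕ) (hN : 2 ≤ N) (J : Fin (N - 1) → ℝ) (hJ : ∀ n, 0 < J n) (b : ℝ) :
    SpinChain.HasEndToEndPST (lt_of_lt_of_le Nat.two_pos hN)
      (SpinChain.heisenbergHamiltonian N J (fun _ => b)) ↔ N = 2 := by
  constructor
  · rintro ⟨t, ht, φ, h⟩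
    rw [SpinChain.excitation_eq_siteVec, SpinChain.excitation_eq_siteVec] at h
    refine SpinChain.length_eq_two_of_transfer hN hJ ht ?_ h
    rw [Complex.star_def, ← Complex.exp_conj, ← Complex.exp_add]
    simp
  · rintro rfl
    refine ⟨Real.pi / (4 * J 0), div_pos Real.pi_pos (mul_pos (by norm_num) (hJ 0)),
      -(Real.pi / (4 * J 0) * ∑ n, J n), ?_⟩
    rw [SpinChain.excitation_eq_siteVec, SpinChain.excitation_eq_siteVec]
    exact SpinChain.transfer_of_length_two hJ b
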